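/- Let $k$ be a field of characteristic $0$ and let $(R,\mathfrak m,k_R)$ be a regular (noetherian) local $k$-algebra of dimension $n$ whose residue field $k_R=R/\mathfrak m$ is algebraic over $k$. Assume that $R$ satisfies the weak Jacobian condition $(WJ)_k$: there exist $k$-linear derivations $\partial_1,\dots,\partial_n$ of $R$ and elements $f_1,\dots,f_n\in\mathfrak m$ such that $\det(\partial_i(f_j))\notin\mathfrak m$. Let $\mathcal D_R=\bigcup_{m\ge 0}\mathcal D_R^m\subset \operatorname{End}_k(R)$ be the ring of $k$-linear differential operators of $R$, where $\mathcal D_R^0=\operatorname{End}_R(R)=R$ and $\mathcal D_R^{m+1}=\{P\in\operatorname{End}_k(R) : Pr-rP\in\mathcal D_R^m \text{ for all } r\in R\}$. For a left $\mathcal D_R$-module $M$ put $M^{\mathfrak m}=\{v\in M : \mathfrak m\cdot v=0\}$, a vector space over $k_R$. Let $M$ be a left $\mathcal D_R$-module which is generated by $M^{\mathfrak m}$. Then $M$ is semisimple. More precisely, if $S$ is any basis of the $k_R$-vector space $M^{\mathfrak m}$, then $$M=\bigoplus_{v\in S}\mathcal D_R v,$$ and each $\mathcal D_R v$ ($v\in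 S$) is isomorphic, as a $\mathcal D_R$-module, to $\mathcal D_R/\mathcal D_R\mathfrak m$. Moreover, the $\mathcal D_R$-module $\mathcal D_R/\mathcal D_R\mathfrak m$ is simple, and $\dim_{k_R}(\mathcal D_R/\mathcal D_R\mathfrak m)^{\mathfrak m}=1$. -/

import Mathlib

noncomputable section

namespace DiffOp

open IsLocalRing

section Ring

variable (k R : Type*) [Field k] [CommRing R] [Algebra k R]

/-- `order k R m` is the space `D_R^m ⊆ End_k(R)` of `k`-linear differential operators of order
at most `m`: `D_R^0 = End_R(R)` and `D_R^(m+1) = {P | [P, r] ∈ D_R^m for all r ∈ R}`, where `r ∈ R`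
is identified with the multiplication operator `LinearMap.mulLeft k r`. -/
def order : ℕ → Submodule k (Module.End k R)
  | 0 =>
    { carrier := {P | ∀ r x : R, P (r * x) = r * P x}
      zero_mem' := by intro r x; simp
      add_mem' := by intro P Q hP hQ r x; simp [hP r x, hQ r x, mul_add]
      smul_mem' := by intro c P hP r x; simp [hP r x] }
  | m + 1 =>
    { carrier := {P | ∀ r : R, P * LinearMap.mulLeft k r - LinearMap.mulLeft k r * P ∈ order m}
      zero_mem' := by intro r; simp
      add_mem' := by
        intro P Q hP hQ r
        have h := (order m).add_mem (hP r) (hQ r)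
        rwa [show (P + Q) * LinearMap.mulLeft k r - LinearMap.mulLeft k r * (P + Q) =
          P * LinearMap.mulLeft k r - LinearMap.mulLeft k r * P +
            (Q * LinearMap.mulLeft k r - LinearMap.mulLeft k r * Q) by noncomm_ring]
      smul_mem' := by
        intro c P hP r
        have h := (order m).smul_mem c (hP r)
        rwa [smul_sub, ← smul_mul_assoc, ← mul_smul_comm] at h }

variable {k R}

theorem mem_order_zero {P : Module.End k R} :
    P ∈ order k R 0 ↔ ∀ r x : R, P (r * x) = r * P x := Iff.rfl

theorem mem_order_succ {m : ℕ} {P : Module.End k R} :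
    P ∈ order k R (m + 1) ↔
      ∀ r : R, P * LinearMap.mulLeft k r - LinearMap.mulLeft k r * P ∈ order k R m := Iff.rfl

theorem commutator_eq_zero {P : Module.End k R} (hP : P ∈ order k R 0) (r : R) :
    P * LinearMap.mulLeft k r - LinearMap.mulLeft k r * P = 0 := by
  ext x
  simp [mem_order_zero.1 hP r x]

theorem order_le_succ (m : ℕ) : order k R m ≤ order k R (m + 1) := by
  induction m with
  | zero =>
    intro P hP r
    rw [commutator_eq_zero hP r]
    exact Submodule.zero_mem _
  | succ m ih => exact fun P hP r => ih (hP r)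

theorem order_mono : Monotone (order k R) := monotone_nat_of_le_succ order_le_succ

theorem mulLeft_mem_order (r : R) : LinearMap.mulLeft k r ∈ order k R 0 := by
  intro s x
  simp only [LinearMap.mulLeft_apply]
  ring

theorem commutator_mul (P Q T : Module.End k R) :
    P * Q * T - T * (P * Q) = P * (Q * T - T * Q) + (P * T - T * P) * Q := by
  rw [mul_sub, sub_mul, mul_assoc, mul_assoc, mul_assoc]
  abel

theorem mul_mem_order {m n : ℕ} {P Q : Module.End k R} (hP : P ∈ order k R m)
    (hQ : Q ∈ order k R n) : P * Q ∈ order k R (m + n) := by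
  induction m generalizing n P Q with
  | zero =>
    induction n generalizing Q with
    | zero =>
      intro r x
      simp only [Module.End.mul_apply]
      rw [mem_order_zero.1 hQ, mem_order_zero.1 hP]
    | succ n ih =>
      intro r
      have h := ih (hQ r)
      rw [commutator_mul,
        commutator_eq_zero hP r, zero_mul, add_zero]
      exact h
  | succ m ihm =>
    induction n generalizing Q with
    | zero =>
      intro r
      have h := ihm (hP r) hQ
      rw [commutator_mul,
        commutator_eq_zero hQ r, mul_zero, zero_add]
      exact h
    | succ n ihn =>
      intro r
      have h1 := ihn (hQ r)
      have h2 := ihm (hP r) hQ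
      rw [show m + (n + 1) = m + 1 + n by ring] at h2
      rw [commutator_mul]
      exact Submodule.add_mem _ h1 h2

end Ring

variable (k R : Type*) [Field k] [CommRing R] [Algebra k R]

/-- The ring `D_R = ⋃_m D_R^m ⊆ End_k(R)` of `k`-linear differential operators of `R`. -/
def diffOps : Subring (Module.End k R) where
  carrier := {P | ∃ m : ℕ, P ∈ order k R m}
  mul_mem' := by
    rintro P Q ⟨m, hP⟩ ⟨n, hQ⟩
    exact ⟨m + n, mul_mem_order hP hQ⟩
  add_mem' := by
    rintro P Q ⟨m, hP⟩ ⟨n, hQ⟩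
    exact ⟨max m n, Submodule.add_mem _ (order_mono (le_max_left m n) hP)
      (order_mono (le_max_right m n) hQ)⟩
  one_mem' := ⟨0, fun r x => rfl⟩
  zero_mem' := ⟨0, Submodule.zero_mem _⟩
  neg_mem' := by
    rintro P ⟨m, hP⟩
    exact ⟨m, Submodule.neg_mem _ hP⟩

/-- The inclusion `R ⊆ D_R`, sending `r` to the operator of multiplication by `r`. -/
def ofRing : R →+* diffOps k R :=
  (Algebra.lmul k R).toRingHom.codRestrict (diffOps k R) (fun r => ⟨0, mulLeft_mem_order r⟩)

@[simp] theorem ofRing_apply (r x : R) : (ofRing k R r : Module.End k R) x = r * x := rfl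

/-- The weak Jacobian condition `(WJ)_k` for a local `k`-algebra `R` of dimension `n`: there are
`k`-linear derivations `∂_1, …, ∂_n` of `R` and elements `f_1, …, f_n` of the maximal ideal `𝔪`
such that `det (∂_i (f_j)) ∉ 𝔪`. -/
def WeakJacobian [IsLocalRing R] : Prop :=
  ∃ n : ℕ, ringKrullDim R = n ∧
    ∃ (d : Fin n → Derivation k R R) (f : Fin n → R),
      (∀ j, f j ∈ maximalIdeal R) ∧
        (Matrix.of fun i j => d i (f j)).det ∉ maximalIdeal R

/-- The left ideal `D_R 𝔪` of `D_R` generated by the maximal ideal `𝔪` of `R`. -/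
def leftIdeal [IsLocalRing R] : Submodule (diffOps k R) (diffOps k R) :=
  Submodule.span (diffOps k R) (ofRing k R '' (maximalIdeal R : Set R))

section Invariants

variable [IsLocalRing R] (M : Type*) [AddCommGroup M] [Module (diffOps k R) M]

/-- The `𝔪`-invariants `M^𝔪 = {v ∈ M | 𝔪 v = 0}` of a `D_R`-module `M`. -/
def invariants : AddSubgroup M where
  carrier := {v | ∀ r ∈ maximalIdeal R, ofRing k R r • v = 0}
  zero_mem' := by intro r _; simp
  add_mem' := by intro v w hv hw r hr; rw [smul_add, hv r hr, hw r hr, add_zero]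
  neg_mem' := by intro v hv r hr; rw [smul_neg, hv r hr, neg_zero]

variable {M} in
theorem mem_invariants {v : M} :
    v ∈ invariants k R M ↔ ∀ r ∈ maximalIdeal R, ofRing k R r • v = 0 := Iff.rfl

/-- `R` acts on `M^𝔪` through the inclusion `R ⊆ D_R`. -/
instance invariantsModule : Module R (invariants k R M) where
  smul r v := ⟨ofRing k R r • (v : M), fun s hs => by
    rw [← mul_smul, ← map_mul, mul_comm, map_mul, mul_smul, v.2 s hs, smul_zero]⟩
  one_smul v := Subtype.ext (show ofRing k R 1 • (v : M) = v by rw [map_one, one_smul])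
  mul_smul r s v := Subtype.ext
    (show ofRing k R (r * s) • (v : M) = ofRing k R r • ofRing k R s • (v : M) by
      rw [map_mul, mul_smul])
  smul_zero r := Subtype.ext (smul_zero (ofRing k R r))
  smul_add r v w := Subtype.ext (smul_add (ofRing k R r) (v : M) (w : M))
  add_smul r s v := Subtype.ext
    (show ofRing k R (r + s) • (v : M) = ofRing k R r • (v : M) + ofRing k R s • (v : M) by
      rw [map_add, add_smul])
  zero_smul v := Subtype.ext (show ofRing k R 0 • (v : M) = 0 by rw [map_zero, zero_smul])

theorem isTorsionBySet_invariants :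
    Module.IsTorsionBySet R (invariants k R M) (maximalIdeal R : Set R) :=
  fun v r => Subtype.ext (v.2 r r.2)

/-- The induced structure of a vector space over the residue field `k_R = R/𝔪` on `M^𝔪`. -/
instance invariantsResidueModule : Module (ResidueField R) (invariants k R M) :=
  (isTorsionBySet_invariants k R M).module

theorem coe_residue_smul (r : R) (v : invariants k R M) :
    ((residue R r • v : invariants k R M) : M) = ofRing k R r • (v : M) := rfl

end Invariants

end DiffOp

end

/-! Multiplying the derivations by the inverse Jacobian matrix gives `d i (f j) = δ_ij`, and
regularity forces the `f j` to generate `𝔪` (`exists_coordinates`). Since `[d i, f i] = 1` and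
commutation with `f i` is nilpotent on differential operators, the exponential-type sum `proj`
projects an operator to the centralizer of `f i`. An operator commuting with every `f i` lies in `R`
(`mem_order_zero_of_commute`).

The projection does not change the value `P • v` when both `v` and `P • v` are `𝔪`-invariant. Hence
the invariant vectors of `D_R v` are just `k_R v` (`exists_ofRing_smul_eq`). Every element of `D_R
v` is killed by a power of `𝔪`, so a nonzero submodule contains a nonzero invariant vector, which is
a unit multiple of `v`: `D_R v` is simple. The same argument applied to the kernel of `⨁ D_R v → M`
reduces directness to linear independence over `k_R`. Projecting coefficients also turns `1 ∈ D_R 𝔪`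
into `1 ∈ 𝔪`, so the quotient is nonzero. -/

noncomputable section

namespace DiffOp

open IsLocalRing

/-! ### Projection to centralizers in an abstract algebra -/

section Commutator

variable {k B : Type*} [Field k] [Ring B] [Algebra k B]

variable (k) in
/-- The commutator `P ↦ P f - f P`. -/
def comm (f : B) : Module.End k B := LinearMap.mulRight k f - LinearMap.mulLeft k f

@[simp] theorem comm_apply (f P : B) : comm k f P = P * f - f * P := rfl

theorem comm_mul (f P Q : B) : comm k f (P * Q) = P * comm k f Q + comm k f P * Q := by
  simp only [comm_apply]
  noncomm_ring

theorem comm_mul_of_commute (f P : B) {Q : B} (h : Commute Q f) :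
    comm k f (P * Q) = comm k f P * Q := by
  rw [comm_mul, comm_apply f Q, h.eq, sub_self, mul_zero, zero_add]

theorem comm_pow_mul_of_commute (f P : B) {Q : B} (h : Commute Q f) (i : ℕ) :
    (comm k f ^ i) (P * Q) = (comm k f ^ i) P * Q := by
  induction i with
  | zero => simp
  | succ i ih => rw [pow_succ', Module.End.mul_apply, ih, comm_mul_of_commute _ _ h,
      Module.End.mul_apply]

theorem comm_pow_eq {d f : B} (h : d * f - f * d = 1) (i : ℕ) :
    comm k f (d ^ (i + 1)) = (i + 1) • d ^ i := by
  induction i with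
  | zero => simpa using h
  | succ i ih =>
    rw [pow_succ', comm_mul, ih, comm_apply f d, h, one_mul, mul_smul_comm, ← pow_succ',
      succ_nsmul _ (i + 1)]

theorem commute_comm_pow {f g P : B} (hfg : Commute f g) (hP : Commute P g) (i : ℕ) :
    Commute ((comm k f ^ i) P) g := by
  induction i with
  | zero => simpa
  | succ i ih =>
    rw [pow_succ', Module.End.mul_apply, comm_apply]
    exact (ih.mul_left hfg).sub_left (hfg.mul_left ih)

/-- The truncated exponential series `∑ (-1)^i / i! d^i [⋯[P, f], ⋯, f]`. For `[d, f] = 1` and `s`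
large, it projects `P` to the centralizer of `f`. -/
def proj (k : Type*) {B : Type*} [Field k] [Ring B] [Algebra k B] (d f : B) (s : ℕ) (P : B) : B :=
  ∑ i ∈ Finset.range (s + 1), ((-1) ^ i * (i.factorial : k)⁻¹) • (d ^ i * (comm k f ^ i) P)

theorem proj_mul_of_commute (d f : B) (s : ℕ) (P : B) {Q : B} (h : Commute Q f) :
    proj k d f s (P * Q) = proj k d f s P * Q := by
  simp only [proj, Finset.sum_mul, comm_pow_mul_of_commute f P h, smul_mul_assoc, mul_assoc]

theorem proj_sum {ι : Type*} (T : Finset ι) (d f : B) (s : ℕ) (P : ι → B) :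
    proj k d f s (∑ i ∈ T, P i) = ∑ i ∈ T, proj k d f s (P i) := by
  simp only [proj, map_sum, Finset.mul_sum, Finset.smul_sum]
  exact Finset.sum_comm

theorem proj_eq_self (d f : B) (s : ℕ) {P : B} (h : Commute P f) : proj k d f s P = P := by
  rw [proj, Finset.sum_range_succ', Finset.sum_eq_zero, zero_add]
  · simp
  · intro i _
    rw [pow_succ (comm k f), Module.End.mul_apply, comm_apply, h.eq, sub_self, map_zero, mul_zero,
      smul_zero]

theorem commute_proj {d f g P : B} (hd : Commute d g) (hf : Commute f g) (hP : Commute P g)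
    (s : ℕ) : Commute (proj k d f s P) g :=
  Commute.sum_left _ _ _ fun i _ =>
    (((hd.pow_left i).mul_left (commute_comm_pow hf hP i)).smul_left _)

/-- The sum telescopes: the commutator of `d ^ (i + 1)` with `f` is `(i + 1) • d ^ i`, and the
alternating factorials cancel consecutive contributions. Only the top term survives. -/
theorem comm_proj [CharZero k] {d f : B} (h : d * f - f * d = 1) (s : ℕ) (P : B) :
    comm k f (proj k d f s P) =
      ((-1) ^ s * (s.factorial : k)⁻¹) • (d ^ s * (comm k f ^ (s + 1)) P) := by
  induction s with
  | zero => simp [proj]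
  | succ s ih =>
    rw [proj, Finset.sum_range_succ, map_add, ← proj, ih, map_smul, comm_mul, comm_pow_eq h,
      smul_add, ← Module.End.mul_apply, ← pow_succ', add_left_comm, ← Nat.cast_smul_eq_nsmul k,
      smul_mul_assoc, smul_smul, ← add_smul]
    convert add_zero _ using 2
    convert zero_smul k _ using 2
    have : ((s + 1 : ℕ) : k) ≠ 0 := Nat.cast_ne_zero.2 s.succ_ne_zero
    have : (s.factorial : k) ≠ 0 := Nat.cast_ne_zero.2 s.factorial_ne_zero
    rw [Nat.factorial_succ, Nat.cast_mul]
    field_simp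
    ring

theorem commute_proj_self [CharZero k] {d f : B} (h : d * f - f * d = 1) {s : ℕ} {P : B}
    (hP : (comm k f ^ (s + 1)) P = 0) : Commute (proj k d f s P) f := by
  rw [Commute, SemiconjBy, ← sub_eq_zero, ← comm_apply (k := k), comm_proj h, hP, mul_zero,
    smul_zero]

theorem smul_eq_zero_of_comm_pow {M : Type*} [AddCommGroup M] [Module B M] {f P : B} {v : M}
    (hv : f • v = 0) (hPv : f • P • v = 0) (i : ℕ) : (comm k f ^ (i + 1)) P • v = 0 := by
  induction i with
  | zero => simp [sub_smul, mul_smul, hv, hPv]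
  | succ i ih =>
    rw [pow_succ', Module.End.mul_apply, comm_apply, sub_smul, mul_smul, mul_smul, hv, ih,
      smul_zero, smul_zero, sub_zero]

/-- As `f` kills both `v` and `P • v`, every iterated commutator of `P` with `f` kills `v`, leaving
only the term `i = 0`. -/
theorem proj_smul {M : Type*} [AddCommGroup M] [Module B M] (d : B) {f P : B} {v : M} (s : ℕ)
    (hv : f • v = 0) (hPv : f • P • v = 0) : proj k d f s P • v = P • v := by
  rw [proj, Finset.sum_range_succ', add_smul, Finset.sum_smul, Finset.sum_eq_zero, zero_add]
  · simp
  · intro i _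
    rw [← mul_smul_comm, mul_smul, Algebra.smul_def, mul_smul,
      smul_eq_zero_of_comm_pow hv hPv, smul_zero, smul_zero]

variable [CharZero k] {ι : Type*} [DecidableEq ι] {d f : ι → B}
  (hd : ∀ i j, d i * f j - f j * d i = if i = j then 1 else 0) (hf : ∀ i j, Commute (f i) (f j))
  (hnil : ∀ P i, ∃ s, ∀ t ≥ s, (comm k (f i) ^ t) P = 0)

include hd hf hnil

/-- Project for one index at a time. Commutation with earlier `f i` survives, because `d j` commutes
with `f i` for `i ≠ j`; the `d i` need not commute with each other. -/
theorem exists_commute_smul_eq {M : Type*} [AddCommGroup M] [Module B M] {v w : M}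
    (hv : ∀ i, f i • v = 0) (hw : ∀ i, f i • w = 0) (P : B) (hP : P • v = w) (T : Finset ι) :
    ∃ Q : B, (∀ i ∈ T, Commute Q (f i)) ∧ Q • v = w := by
  induction T using Finset.induction_on with
  | empty => exact ⟨P, by simp, hP⟩
  | insert j T hj ih =>
    obtain ⟨Q, hQ, hQv⟩ := ih
    obtain ⟨s, hs⟩ := hnil Q j
    refine ⟨proj k (d j) (f j) s Q, fun i hi => ?_, ?_⟩
    · obtain rfl | hi := Finset.mem_insert.1 hi
      · exact commute_proj_self (by simp [hd]) (hs _ (Nat.le_succ s))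
      · refine commute_proj ?_ (hf _ _) (hQ i hi) s
        have := hd j i
        rw [if_neg (by rintro rfl; exact hj hi), sub_eq_zero] at this
        exact this
    · rw [proj_smul _ _ (hv j) (by rw [hQv, hw]), hQv]

/-- `proj` fixes `1` and is right-linear over the centralizer of `f j`, so applying it to the
relation changes only the coefficients. -/
theorem exists_commute_sum_eq_one {α : Type*} (A : Finset α) (g : α → B)
    (hg : ∀ a i, Commute (g a) (f i)) (P : α → B) (hP : ∑ a ∈ A, P a * g a = 1) (T : Finset ι) :
    ∃ Q : α → B, (∀ a, ∀ i ∈ T, a ∈ A → Commute (Q a) (f i)) ∧ ∑ a ∈ A, Q a * g a = 1 := by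
  induction T using Finset.induction_on with
  | empty => exact ⟨P, by simp, hP⟩
  | insert j T hj ih =>
    obtain ⟨Q, hQ, hQ1⟩ := ih
    choose s hs using fun a => hnil (Q a) j
    -- A truncation common to all coefficients is needed to pull `proj` out of the sum.
    refine ⟨fun a => proj k (d j) (f j) (A.sup s) (Q a), fun a i hi ha => ?_, ?_⟩
    · obtain rfl | hi := Finset.mem_insert.1 hi
      · exact commute_proj_self (by simp [hd])
          (hs a _ ((Finset.le_sup ha).trans (Nat.le_succ _)))
      · refine commute_proj ?_ (hf _ _) (hQ a i hi ha) _
        have := hd j i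
        rw [if_neg (by rintro rfl; exact hj hi), sub_eq_zero] at this
        exact this
    · simp only [← proj_mul_of_commute _ _ _ _ (hg _ j)]
      rw [← proj_sum, hQ1, proj_eq_self _ _ _ (Commute.one_left _)]

end Commutator

/-! ### Coordinates and operators commuting with them -/

section Coordinates

variable {k R : Type*} [Field k] [CommRing R] [Algebra k R]

/-- If a derivation kills generators of `𝔪`, the residue field is separable algebraic and `R` is
noetherian, then the derivation is zero. -/
theorem derivation_eq_zero [CharZero k] [IsLocalRing R] [IsNoetherianRing R]
    [Algebra.IsAlgebraic k (ResidueField R)] {ι : Type*} [Fintype ι] {f : ι → R}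
    (hf : Ideal.span (Set.range f) = maximalIdeal R) (δ : Derivation k R R)
    (hδ : ∀ j, δ (f j) = 0) : δ = 0 := by
  -- Krull's intersection theorem then finishes the proof.
  have key : ∀ s : ℕ, ∀ x, δ x ∈ maximalIdeal R ^ s := by
    intro s
    induction s with
    | zero => simp
    | succ s ih =>
      have hm : ∀ x ∈ maximalIdeal R, δ x ∈ maximalIdeal R ^ (s + 1) := by
        intro x hx
        rw [← hf] at hx
        obtain ⟨c, rfl⟩ := (Ideal.mem_span_range_iff_exists_fun).1 hx
        rw [map_sum]
        refine Ideal.sum_mem _ fun j _ => ?_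
        rw [Derivation.leibniz, hδ, smul_zero, zero_add, smul_eq_mul, pow_succ']
        exact Ideal.mul_mem_mul (hf ▸ Ideal.subset_span ⟨j, rfl⟩) (ih _)
      intro x
      have hint : IsIntegral k (residue R x) := Algebra.IsIntegral.isIntegral _
      set p := minpoly k (residue R x)
      have hres : ∀ q : Polynomial k,
          Polynomial.aeval (residue R x) q = residue R (Polynomial.aeval x q) := fun q =>
        Polynomial.aeval_algebraMap_apply (ResidueField R) x q
      have h1 : Polynomial.aeval x p ∈ maximalIdeal R := by
        rw [← residue_eq_zero_iff, ← hres, minpoly.aeval]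
      -- Separability in characteristic zero makes `p'(x)` a unit, so `δ (p(x)) = p'(x) δ x`
      -- transfers the bound from `p(x) ∈ 𝔪` to `x`.
      have h2 : IsUnit (Polynomial.aeval x (Polynomial.derivative p)) := by
        have : residue R (Polynomial.aeval x (Polynomial.derivative p)) ≠ 0 := by
          rw [← hres]
          exact (minpoly.irreducible hint).separable.aeval_derivative_ne_zero
            (minpoly.aeval k (residue R x))
        exact (residue_ne_zero_iff_isUnit _).1 this
      have h3 := hm _ h1
      rw [Derivation.map_aeval, smul_eq_mul] at h3
      exact (Ideal.unit_mul_mem_iff_mem _ h2).1 h3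
  ext x
  have : δ x ∈ ⨅ s : ℕ, maximalIdeal R ^ s := by simpa using fun s => key s x
  rwa [Ideal.iInf_pow_eq_bot_of_isLocalRing _ (maximalIdeal.isMaximal R).ne_top] at this

/-- The dual form of the weak Jacobian condition. -/
theorem exists_coordinates [IsRegularLocalRing R] (h : WeakJacobian k R) :
    ∃ (n : ℕ) (d : Fin n → Derivation k R R) (f : Fin n → R),
      Ideal.span (Set.range f) = maximalIdeal R ∧ ∀ i j, d i (f j) = if i = j then 1 else 0 := by
  obtain ⟨n, hn, d, f, hf, hdet⟩ := h
  set J : Matrix (Fin n) (Fin n) R := Matrix.of fun i j => d i (f j) with hJ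
  have hu : IsUnit J.det := by simpa using hdet
  let d' : Fin n → Derivation k R R := fun i => ∑ l, J⁻¹ i l • d l
  have hd' : ∀ i j, d' i (f j) = if i = j then 1 else 0 := by
    intro i j
    have := congrFun (congrFun (Matrix.nonsing_inv_mul J hu) i) j
    rw [Matrix.mul_apply, Matrix.one_apply] at this
    rw [← this, ← Derivation.coeFnAddMonoidHom_apply, map_sum, Finset.sum_apply]
    simp [hJ]
  refine ⟨n, d', f, ?_, hd'⟩
  let g : Fin n → maximalIdeal R := fun j => ⟨f j, hf j⟩
  have hsq : ∀ i, ∀ x ∈ maximalIdeal R ^ 2, d' i x ∈ maximalIdeal R := by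
    intro i x hx
    rw [pow_two] at hx
    refine Submodule.mul_induction_on hx (fun a ha b hb => ?_) fun a b ha hb => ?_
    · rw [Derivation.leibniz]
      exact Ideal.add_mem _ (Ideal.mul_mem_right _ _ ha) (Ideal.mul_mem_right _ _ hb)
    · rw [map_add]; exact Ideal.add_mem _ ha hb
  -- A relation lifts to an element of `𝔪 ^ 2`; applying `d' i` isolates its `i`-th coefficient
  -- modulo `𝔪`.
  have hli : LinearIndependent (ResidueField R) fun j => (maximalIdeal R).toCotangent (g j) := by
    rw [Fintype.linearIndependent_iff]
    intro c hc i
    choose a ha using fun j => residue_surjective (c j)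
    have h0 : (maximalIdeal R).toCotangent (∑ j, a j • g j) = 0 := by
      rw [map_sum, ← hc]
      refine Finset.sum_congr rfl fun j _ => ?_
      rw [map_smul, ← ha]
      rfl
    rw [Ideal.toCotangent_eq_zero] at h0
    have h1 := hsq i _ h0
    rw [← ha, residue_eq_zero_iff]
    have h2 : ((∑ j, a j • g j : maximalIdeal R) : R) = ∑ j, a j * f j := by
      simp [g]
    rw [h2, map_sum] at h1
    simp only [Derivation.leibniz, hd', smul_eq_mul, mul_ite, mul_one, mul_zero] at h1
    rw [Finset.sum_add_distrib, Finset.sum_ite_eq, if_pos (Finset.mem_univ _)] at h1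
    exact (Ideal.add_mem_iff_left _
      (Ideal.sum_mem _ fun j _ => Ideal.mul_mem_right _ _ (hf j))).1 h1
  -- By regularity the `n` independent classes form a basis of the cotangent space, and Nakayama
  -- lifts them to generators of `𝔪`.
  have hcard : Module.finrank (ResidueField R) (CotangentSpace R) = n := by
    have := (IsRegularLocalRing.iff_finrank_cotangentSpace R).1 inferInstance
    rw [hn] at this
    exact_mod_cast this
  have hspan := hli.span_eq_top_of_card_eq_finrank' (by simpa using hcard.symm)
  rw [show (Set.range fun j => (maximalIdeal R).toCotangent (g j)) =
    (maximalIdeal R).toCotangent '' Set.range g by rw [← Set.range_comp]; rfl,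
    CotangentSpace.span_image_eq_top_iff] at hspan
  have := congrArg (Submodule.map (maximalIdeal R).subtype) hspan
  rw [Submodule.map_span, ← Set.range_comp, Submodule.map_top, Submodule.range_subtype] at this
  exact this

/-- By induction on the order the commutators `[P, r]` are `R`-linear, which makes `P - P 1` a
derivation. It kills the generators of `𝔪`, hence vanishes. -/
theorem mem_order_zero_of_commute [CharZero k] [IsLocalRing R] [IsNoetherianRing R]
    [Algebra.IsAlgebraic k (ResidueField R)] {ι : Type*} [Fintype ι] {f : ι → R}
    (hf : Ideal.span (Set.range f) = maximalIdeal R) {s : ℕ} {P : Module.End k R}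
    (hP : P ∈ order k R s) (h : ∀ j, Commute P (LinearMap.mulLeft k (f j))) :
    P ∈ order k R 0 := by
  induction s generalizing P with
  | zero => exact hP
  | succ s ih =>
    have hcomm : ∀ r, P * LinearMap.mulLeft k r - LinearMap.mulLeft k r * P ∈ order k R 0 := by
      intro r
      refine ih (hP r) fun j => ?_
      have hr : Commute (LinearMap.mulLeft k r) (LinearMap.mulLeft k (f j)) := by
        ext x; simp [mul_left_comm]
      exact ((h j).mul_left hr).sub_left (hr.mul_left (h j))
    have hval : ∀ r x, P (r * x) - r * P x = x * (P r - r * P 1) := by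
      intro r x
      have := mem_order_zero.1 (hcomm r) x 1
      simpa using this
    let δ : Derivation k R R := Derivation.mk' (P - LinearMap.mulRight k (P 1)) fun a b => by
      have := hval a b
      simp only [LinearMap.sub_apply, LinearMap.mulRight_apply, smul_eq_mul]
      linear_combination this
    have hδ : ∀ x, δ x = P x - x * P 1 := fun x => rfl
    have h0 : δ = 0 := derivation_eq_zero hf δ fun j => by
      have := congrArg (fun Q : Module.End k R => Q 1) (h j).eq
      rw [hδ, sub_eq_zero]
      simpa using this
    intro r x
    have h1 := hδ r
    rw [h0, Derivation.zero_apply] at h1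
    rw [← sub_eq_zero, hval, ← h1, mul_zero]

end Coordinates

/-! ### Invariant vectors and the ring of differential operators -/

section Operators

variable {k R : Type*} [Field k] [CommRing R] [Algebra k R]

instance diffOpsAlgebra : Algebra k (diffOps k R) :=
  RingHom.toAlgebra' ((ofRing k R).comp (algebraMap k R)) fun c P => by
    apply Subtype.ext
    ext x
    change algebraMap k R c * (P : Module.End k R) x = (P : Module.End k R) (algebraMap k R c * x)
    rw [← Algebra.smul_def, ← Algebra.smul_def, map_smul]

theorem exists_eq_ofRing {P : diffOps k R} (hP : (P : Module.End k R) ∈ order k R 0) :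
    ∃ a, P = ofRing k R a := by
  refine ⟨(P : Module.End k R) 1, Subtype.ext (LinearMap.ext fun x => ?_)⟩
  have := mem_order_zero.1 hP x 1
  rw [mul_one] at this
  rw [this, ofRing_apply, mul_comm]

theorem comm_ofRing_mem_order {P : diffOps k R} {m : ℕ}
    (hP : (P : Module.End k R) ∈ order k R (m + 1)) (r : R) :
    ((P * ofRing k R r - ofRing k R r * P : diffOps k R) : Module.End k R) ∈ order k R m :=
  hP r

theorem comm_ofRing_eq_zero {P : diffOps k R} (hP : (P : Module.End k R) ∈ order k R 0) (r : R) :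
    P * ofRing k R r - ofRing k R r * P = 0 :=
  Subtype.ext (commutator_eq_zero hP r)

theorem comm_pow_eq_zero {P : diffOps k R} {m : ℕ} (hP : (P : Module.End k R) ∈ order k R m)
    (r : R) : ∀ t ≥ m + 1, (comm k (ofRing k R r) ^ t) P = 0 := by
  induction m generalizing P with
  | zero =>
    intro t ht
    obtain ⟨t, rfl⟩ := Nat.exists_eq_add_of_le' ht
    rw [pow_succ, Module.End.mul_apply, comm_apply, comm_ofRing_eq_zero hP, map_zero]
  | succ m ih =>
    intro t ht
    obtain ⟨t, rfl⟩ := Nat.exists_eq_add_of_le' (show 1 ≤ t by omega)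
    rw [pow_succ, Module.End.mul_apply]
    exact ih (comm_ofRing_mem_order hP r) t (by omega)

/-- A derivation as a differential operator. -/
def ofDerivation (d : Derivation k R R) : diffOps k R :=
  ⟨d, 1, fun r s x => by simp; ring⟩

theorem ofDerivation_comm (d : Derivation k R R) (r : R) :
    ofDerivation d * ofRing k R r - ofRing k R r * ofDerivation d = ofRing k R (d r) := by
  apply Subtype.ext
  ext x
  change d (r * x) - r * d x = d r * x
  rw [Derivation.leibniz, smul_eq_mul, smul_eq_mul]
  ring

theorem commute_ofRing (r s : R) : Commute (ofRing k R r) (ofRing k R s) := by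
  rw [Commute, SemiconjBy, ← map_mul, mul_comm, map_mul]

variable [CharZero k] [IsRegularLocalRing R] [Algebra.IsAlgebraic k (ResidueField R)]

/-- An operator sending an `𝔪`-invariant vector to an `𝔪`-invariant vector acts on it as an
element of `R`. -/
theorem exists_ofRing_smul_eq (hWJ : WeakJacobian k R) {M : Type*} [AddCommGroup M]
    [Module (diffOps k R) M] {v w : M} (hv : v ∈ invariants k R M) (hw : w ∈ invariants k R M)
    (P : diffOps k R) (hP : P • v = w) : ∃ a : R, ofRing k R a • v = w := by
  obtain ⟨n, d, f, hf, hd⟩ := exists_coordinates hWJ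
  have hfm : ∀ i, f i ∈ maximalIdeal R := fun i => hf ▸ Ideal.subset_span ⟨i, rfl⟩
  obtain ⟨Q, hQ, rfl⟩ := exists_commute_smul_eq (k := k) (d := fun i => ofDerivation (d i))
    (f := fun i => ofRing k R (f i))
    (fun i j => by rw [ofDerivation_comm, hd]; split_ifs <;> simp)
    (fun i j => commute_ofRing _ _)
    (fun P i => by
      obtain ⟨m, hm⟩ := P.2
      exact ⟨m + 1, comm_pow_eq_zero hm _⟩)
    (fun i => hv _ (hfm i)) (fun i => hw _ (hfm i)) P hP Finset.univ
  obtain ⟨m, hm⟩ := Q.2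
  obtain ⟨a, ha⟩ := exists_eq_ofRing (mem_order_zero_of_commute hf hm fun j =>
    congrArg Subtype.val (hQ j (Finset.mem_univ j)).eq)
  exact ⟨a, by rw [← ha]⟩

theorem one_notMem_leftIdeal (hWJ : WeakJacobian k R) : (1 : diffOps k R) ∉ leftIdeal k R := by
  intro h
  obtain ⟨n, d, f, hf, hd⟩ := exists_coordinates hWJ
  rw [leftIdeal, Submodule.mem_span_image_iff_exists_fun] at h
  obtain ⟨A, hA, P, hP⟩ := h
  obtain ⟨Q, hQ, hQ1⟩ := exists_commute_sum_eq_one (k := k) (d := fun i => ofDerivation (d i))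
    (f := fun i => ofRing k R (f i))
    (fun i j => by rw [ofDerivation_comm, hd]; split_ifs <;> simp)
    (fun i j => commute_ofRing _ _)
    (fun P i => by
      obtain ⟨m, hm⟩ := P.2
      exact ⟨m + 1, comm_pow_eq_zero hm _⟩)
    Finset.univ (fun a : A => ofRing k R a) (fun a i => commute_ofRing _ _) P hP Finset.univ
  have hR : ∀ a, ∃ c, Q a = ofRing k R c := fun a => by
    obtain ⟨m, hm⟩ := (Q a).2
    exact exists_eq_ofRing (mem_order_zero_of_commute hf hm fun j =>
      congrArg Subtype.val (hQ a j (Finset.mem_univ j) (Finset.mem_univ a)).eq)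
  choose c hc using hR
  -- Evaluation at `1 ∈ R` turns the operator identity into one in `R`, placing `1` in `𝔪`.
  have h1 := congrArg (fun T : diffOps k R => (T : Module.End k R) 1) hQ1
  simp only [hc, ← map_mul, ← map_sum, ofRing_apply, mul_one] at h1
  change ∑ a, c a * (a : R) = 1 at h1
  refine (maximalIdeal R).ne_top_iff_one.1 (maximalIdeal.isMaximal R).ne_top (h1 ▸ ?_)
  exact Ideal.sum_mem _ fun a _ => Ideal.mul_mem_left _ _ (hA a.2)

end Operators

/-! ### Elements killed by powers of the maximal ideal -/

section Torsion

variable {k R : Type*} [Field k] [CommRing R] [Algebra k R] [IsLocalRing R]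
  {M : Type*} [AddCommGroup M] [Module (diffOps k R) M]

/-- Moving a factor from `𝔪` past `P` costs a commutator of lower order, so `m + 1` factors suffice
for order `m`. -/
theorem pow_smul_smul_eq_zero {v : M} (hv : v ∈ invariants k R M) {m : ℕ} {P : diffOps k R}
    (hP : (P : Module.End k R) ∈ order k R m) {r : R} (hr : r ∈ maximalIdeal R ^ (m + 1)) :
    ofRing k R r • P • v = 0 := by
  induction m generalizing P r with
  | zero =>
    rw [zero_add, pow_one] at hr
    rw [← mul_smul, ← sub_eq_zero.1 (comm_ofRing_eq_zero hP r), mul_smul, hv r hr, smul_zero]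
  | succ m ih =>
    rw [pow_succ] at hr
    refine Submodule.mul_induction_on hr (fun a ha b hb => ?_) fun a b ha hb => ?_
    · have h := ih (comm_ofRing_mem_order hP b) ha
      rw [sub_smul, mul_smul, hv b hb, smul_zero, zero_sub, smul_neg, neg_eq_zero] at h
      rw [map_mul, mul_smul, ← mul_smul (ofRing k R b), h]
    · rw [map_add, add_smul, ha, hb, add_zero]

variable (k R) in
/-- The element `x` is killed by a power of the maximal ideal. -/
def IsPowTorsion (x : M) : Prop := ∃ t : ℕ, ∀ r ∈ maximalIdeal R ^ t, ofRing k R r • x = 0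

theorem IsPowTorsion.add {x y : M} (hx : IsPowTorsion k R x) (hy : IsPowTorsion k R y) :
    IsPowTorsion k R (x + y) := by
  obtain ⟨s, hs⟩ := hx
  obtain ⟨t, ht⟩ := hy
  refine ⟨max s t, fun r hr => ?_⟩
  rw [smul_add, hs r (Ideal.pow_le_pow_right (le_max_left s t) hr),
    ht r (Ideal.pow_le_pow_right (le_max_right s t) hr), add_zero]

theorem isPowTorsion_zero : IsPowTorsion k R (0 : M) := ⟨0, fun _ _ => smul_zero _⟩

theorem IsPowTorsion.map {M' : Type*} [AddCommGroup M'] [Module (diffOps k R) M']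
    (φ : M →ₗ[diffOps k R] M') {x : M} (hx : IsPowTorsion k R x) : IsPowTorsion k R (φ x) := by
  obtain ⟨t, ht⟩ := hx
  exact ⟨t, fun r hr => by rw [← map_smul, ht r hr, map_zero]⟩

theorem isPowTorsion_smul {v : M} (hv : v ∈ invariants k R M) (P : diffOps k R) :
    IsPowTorsion k R (P • v) := by
  obtain ⟨m, hm⟩ := P.2
  exact ⟨m + 1, fun r hr => pow_smul_smul_eq_zero hv hm hr⟩

/-- A nonzero torsion element has a nonzero `𝔪`-invariant multiple. -/
theorem IsPowTorsion.exists_smul_mem_invariants {x : M} (hx : IsPowTorsion k R x) (h0 : x ≠ 0) :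
    ∃ r : R, ofRing k R r • x ∈ invariants k R M ∧ ofRing k R r • x ≠ 0 := by
  classical
  obtain ⟨t, ht⟩ : ∃ t, Nat.find hx = t + 1 := by
    refine Nat.exists_eq_succ_of_ne_zero fun h => h0 ?_
    have := Nat.find_spec hx 1 (by rw [h]; simp)
    rwa [map_one, one_smul] at this
  have hmin := Nat.find_min hx (m := t) (by omega)
  push Not at hmin
  obtain ⟨r, hr, hrx⟩ := hmin
  refine ⟨r, fun s hs => ?_, hrx⟩
  rw [← mul_smul, ← map_mul]
  refine Nat.find_spec hx _ ?_
  rw [ht, pow_succ']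
  exact Ideal.mul_mem_mul hs hr

theorem exists_ofRing_smul_eq_of_ne_zero {v : M} (hv : v ∈ invariants k R M) {a : R}
    (h : ofRing k R a • v ≠ 0) : ∃ b : R, ofRing k R b • ofRing k R a • v = v := by
  have ha : IsUnit a := by
    by_contra ha
    exact h (hv a ((mem_maximalIdeal a).2 ha))
  obtain ⟨b, hb⟩ := ha.exists_left_inv
  exact ⟨b, by rw [← mul_smul, ← map_mul, hb, map_one, one_smul]⟩

theorem mkQ_one_mem_invariants :
    (leftIdeal k R).mkQ 1 ∈ invariants k R (diffOps k R ⧸ leftIdeal k R) := by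
  intro r hr
  rw [← map_smul, smul_eq_mul, mul_one, Submodule.mkQ_apply, Submodule.Quotient.mk_eq_zero]
  exact Submodule.subset_span ⟨r, hr, rfl⟩

theorem smul_mkQ_one (P : diffOps k R) : P • (leftIdeal k R).mkQ 1 = (leftIdeal k R).mkQ P := by
  rw [← map_smul, smul_eq_mul, mul_one]

theorem iSup_span_singleton_eq_top
    (hM : Submodule.span (diffOps k R) (invariants k R M : Set M) = ⊤)
    (S : Set (invariants k R M)) (hS : Submodule.span (ResidueField R) S = ⊤) :
    ⨆ v : S, Submodule.span (diffOps k R) {((v : invariants k R M) : M)} = ⊤ := by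
  rw [eq_top_iff, ← hM, Submodule.span_le]
  intro w hw
  have h : (⟨w, hw⟩ : invariants k R M) ∈ Submodule.span (ResidueField R) S := hS ▸ trivial
  suffices ∀ u ∈ Submodule.span (ResidueField R) S,
      (u : M) ∈ ⨆ v : S, Submodule.span (diffOps k R) {((v : invariants k R M) : M)} from
    this _ h
  intro u hu
  induction hu using Submodule.span_induction with
  | mem x hx =>
    exact Submodule.mem_iSup_of_mem ⟨x, hx⟩ (Submodule.mem_span_singleton_self _)
  | zero => exact Submodule.zero_mem _
  | add x y _ _ hx hy => exact Submodule.add_mem _ hx hy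
  | smul c x _ hx =>
    obtain ⟨r, rfl⟩ := residue_surjective c
    exact Submodule.smul_mem _ (ofRing k R r) hx

end Torsion

/-! ### Simplicity, semisimplicity and directness -/

section Simple

variable {k R : Type*} [Field k] [CharZero k] [CommRing R] [IsRegularLocalRing R] [Algebra k R]
  [Algebra.IsAlgebraic k (ResidueField R)] {M : Type*} [AddCommGroup M] [Module (diffOps k R) M]

theorem isSimpleModule_of_span_singleton_eq_top (hWJ : WeakJacobian k R) {v : M}
    (hv : v ∈ invariants k R M) (h0 : v ≠ 0) (htop : Submodule.span (diffOps k R) {v} = ⊤) :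
    IsSimpleModule (diffOps k R) M := by
  have : Nontrivial M := ⟨v, 0, h0⟩
  refine { eq_bot_or_eq_top := fun N => or_iff_not_imp_left.2 fun hN => ?_ }
  obtain ⟨x, hxN, hx⟩ := N.exists_mem_ne_zero_of_ne_bot hN
  obtain ⟨P, rfl⟩ := Submodule.mem_span_singleton.1 (htop ▸ Submodule.mem_top : x ∈ _)
  obtain ⟨r, hr, hr0⟩ := (isPowTorsion_smul hv P).exists_smul_mem_invariants hx
  obtain ⟨a, ha⟩ := exists_ofRing_smul_eq hWJ hv hr (ofRing k R r * P) (mul_smul _ _ _)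
  rw [← ha] at hr0
  obtain ⟨b, hb⟩ := exists_ofRing_smul_eq_of_ne_zero hv hr0
  rw [eq_top_iff, ← htop, Submodule.span_singleton_le_iff_mem, ← hb, ha]
  exact N.smul_mem _ (N.smul_mem _ hxN)

theorem isSimpleModule_span_singleton (hWJ : WeakJacobian k R) {v : M}
    (hv : v ∈ invariants k R M) (h0 : v ≠ 0) :
    IsSimpleModule (diffOps k R) (Submodule.span (diffOps k R) {v}) := by
  refine isSimpleModule_of_span_singleton_eq_top hWJ
    (v := ⟨v, Submodule.mem_span_singleton_self v⟩) (fun r hr => Subtype.ext (hv r hr))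
    (fun h => h0 (congrArg Subtype.val h)) (eq_top_iff.2 ?_)
  rintro ⟨x, hx⟩ -
  obtain ⟨P, rfl⟩ := Submodule.mem_span_singleton.1 hx
  exact Submodule.mem_span_singleton.2 ⟨P, rfl⟩

theorem mkQ_one_ne_zero (hWJ : WeakJacobian k R) : (leftIdeal k R).mkQ 1 ≠ 0 := by
  rw [Submodule.mkQ_apply, Ne, Submodule.Quotient.mk_eq_zero]
  exact one_notMem_leftIdeal hWJ

theorem isSimpleModule_quotient_leftIdeal (hWJ : WeakJacobian k R) :
    IsSimpleModule (diffOps k R) (diffOps k R ⧸ leftIdeal k R) := by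
  refine isSimpleModule_of_span_singleton_eq_top hWJ mkQ_one_mem_invariants
    (mkQ_one_ne_zero hWJ) (eq_top_iff.2 fun x _ => ?_)
  obtain ⟨P, rfl⟩ := (leftIdeal k R).mkQ_surjective x
  exact Submodule.mem_span_singleton.2 ⟨P, smul_mkQ_one P⟩

theorem finrank_invariants_quotient_leftIdeal (hWJ : WeakJacobian k R) :
    Module.finrank (ResidueField R) (invariants k R (diffOps k R ⧸ leftIdeal k R)) = 1 := by
  refine (finrank_eq_one_iff_of_nonzero' ⟨_, mkQ_one_mem_invariants⟩
    fun h => mkQ_one_ne_zero hWJ (congrArg Subtype.val h)).2 ?_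
  rintro ⟨w, hw⟩
  obtain ⟨P, rfl⟩ := (leftIdeal k R).mkQ_surjective w
  obtain ⟨a, ha⟩ := exists_ofRing_smul_eq hWJ mkQ_one_mem_invariants hw P (smul_mkQ_one P)
  exact ⟨residue R a, Subtype.ext ha⟩

theorem nonempty_span_singleton_equiv (hWJ : WeakJacobian k R) {v : M}
    (hv : v ∈ invariants k R M) (h0 : v ≠ 0) :
    Nonempty (Submodule.span (diffOps k R) {v} ≃ₗ[diffOps k R]
      (diffOps k R ⧸ leftIdeal k R)) := by
  have := isSimpleModule_quotient_leftIdeal hWJ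
  have := isSimpleModule_span_singleton hWJ hv h0
  let w : Submodule.span (diffOps k R) {v} := ⟨v, Submodule.mem_span_singleton_self v⟩
  have hw : w ≠ 0 := fun h => h0 (congrArg Subtype.val h)
  have hker : leftIdeal k R ≤ LinearMap.ker (LinearMap.toSpanSingleton (diffOps k R) _ w) := by
    rw [leftIdeal, Submodule.span_le]
    rintro _ ⟨r, hr, rfl⟩
    exact Subtype.ext (hv r hr)
  let φ := (leftIdeal k R).liftQ _ hker
  refine ⟨(LinearEquiv.ofBijective φ (LinearMap.bijective_of_ne_zero fun h => hw ?_)).symm⟩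
  have h1 : φ ((leftIdeal k R).mkQ 1) = w := by
    rw [Submodule.mkQ_apply, Submodule.liftQ_apply, LinearMap.toSpanSingleton_apply, one_smul]
  rw [← h1, h, LinearMap.zero_apply]

theorem isSemisimpleModule_of_span_invariants (hWJ : WeakJacobian k R)
    (hM : Submodule.span (diffOps k R) (invariants k R M : Set M) = ⊤) :
    IsSemisimpleModule (diffOps k R) M := by
  refine isSemisimpleModule_of_isSemisimpleModule_submodule'
    (p := fun v : invariants k R M => Submodule.span (diffOps k R) {(v : M)}) (fun v => ?_) ?_
  · by_cases h0 : (v : M) = 0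
    · rw [h0, Submodule.span_zero_singleton]
      exact { exists_isCompl := fun N => ⟨N, disjoint_iff.2 (Subsingleton.elim _ _),
        codisjoint_iff.2 (Subsingleton.elim _ _)⟩ }
    · have := isSimpleModule_span_singleton hWJ v.2 h0
      infer_instance
  · rw [← hM, ← Submodule.span_range_eq_iSup]
    congr 1
    exact Subtype.range_coe

open DirectSum in
theorem injective_coeLinearMap_span_singleton (hWJ : WeakJacobian k R)
    (S : Set (invariants k R M)) [DecidableEq S]
    (hS : LinearIndependent (ResidueField R) (Subtype.val : S → invariants k R M)) :
    Function.Injective (DirectSum.coeLinearMap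
      fun v : S => Submodule.span (diffOps k R) {((v : invariants k R M) : M)}) := by
  classical
  set A := fun v : S => Submodule.span (diffOps k R) {((v : invariants k R M) : M)}
  have htors : ∀ x : ⨁ v, A v, IsPowTorsion k R x := by
    intro x
    induction x using DirectSum.induction_on with
    | zero => exact isPowTorsion_zero
    | add x y hx hy => exact hx.add hy
    | of v x =>
      refine IsPowTorsion.map (DirectSum.lof (diffOps k R) S (fun v => A v) v) ?_
      obtain ⟨x, hx⟩ := x
      obtain ⟨P, rfl⟩ := Submodule.mem_span_singleton.1 hx
      obtain ⟨t, ht⟩ := isPowTorsion_smul (v : invariants k R M).2 P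
      exact ⟨t, fun r hr => Subtype.ext (ht r hr)⟩
  rw [← LinearMap.ker_eq_bot, LinearMap.ker_eq_bot']
  intro x hx
  by_contra h0
  obtain ⟨r, hr, hr0⟩ := (htors x).exists_smul_mem_invariants h0
  have hy : DirectSum.coeLinearMap A (ofRing k R r • x) = 0 := by rw [map_smul, hx, smul_zero]
  generalize ofRing k R r • x = y at hr hr0 hy
  -- Each component of the invariant kernel element `y` is an invariant vector of `D_R v`, hence an
  -- `R`-multiple of `v`; `hy` becomes a linear relation on `S`.
  have hyv : ∀ v : S, ∃ a : R, ofRing k R a • ((v : invariants k R M) : M) = y v := by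
    intro v
    obtain ⟨P, hP⟩ := Submodule.mem_span_singleton.1 (y v).2
    refine exists_ofRing_smul_eq hWJ (v : invariants k R M).2 (fun s hs => ?_) P hP
    have := congrArg (fun z : ⨁ v, A v => ((z v : A v) : M)) (hr s hs)
    simpa [DirectSum.smul_apply] using this
  choose a ha using hyv
  rw [DirectSum.coeLinearMap_eq_dfinsuppSum, DFinsupp.sum] at hy
  have hsum : ∑ v ∈ DFinsupp.support y, residue R (a v) • (v : invariants k R M) = 0 := by
    apply Subtype.ext
    rw [AddSubgroup.val_finsetSum, AddSubgroup.coe_zero, ← hy]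
    exact Finset.sum_congr rfl fun v _ => (coe_residue_smul k R M _ _).trans (ha v)
  refine hr0 (DFinsupp.ext fun v => ?_)
  by_cases hv : v ∈ DFinsupp.support y
  · have := linearIndependent_iff'.1 hS _ _ hsum v hv
    rw [residue_eq_zero_iff] at this
    exact Subtype.ext ((ha v).symm.trans ((v : invariants k R M).2 _ this))
  · exact DFinsupp.notMem_support_iff.1 hv

end Simple

end DiffOp

end

theorem lemma2p4 {k R M : Type*} [Field k] [CharZero k] [CommRing R] [IsRegularLocalRing R]
    [Algebra k R] [Algebra.IsAlgebraic k (IsLocalRing.ResidueField R)]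
    (hWJ : DiffOp.WeakJacobian k R)
    [AddCommGroup M] [Module (DiffOp.diffOps k R) M]
    (hM : Submodule.span (DiffOp.diffOps k R) (DiffOp.invariants k R M : Set M) = ⊤) :
    IsSemisimpleModule (DiffOp.diffOps k R) M ∧
    (∀ (S : Set (DiffOp.invariants k R M)) [DecidableEq S],
      LinearIndependent (IsLocalRing.ResidueField R)
        (Subtype.val : S → DiffOp.invariants k R M) →
      Submodule.span (IsLocalRing.ResidueField R) S = ⊤ →
      DirectSum.IsInternal
        (fun v : S => Submodule.span (DiffOp.diffOps k R) {((v : DiffOp.invariants k R M) : M)}) ∧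
      ∀ v : S, Nonempty
        (Submodule.span (DiffOp.diffOps k R) {((v : DiffOp.invariants k R M) : M)}
          ≃ₗ[DiffOp.diffOps k R] (DiffOp.diffOps k R ⧸ DiffOp.leftIdeal k R))) ∧
    IsSimpleModule (DiffOp.diffOps k R) (DiffOp.diffOps k R ⧸ DiffOp.leftIdeal k R) ∧
    Module.finrank (IsLocalRing.ResidueField R)
      (DiffOp.invariants k R (DiffOp.diffOps k R ⧸ DiffOp.leftIdeal k R)) = 1 := by
  refine ⟨DiffOp.isSemisimpleModule_of_span_invariants hWJ hM, fun S _ hli hspan =>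
    ⟨⟨DiffOp.injective_coeLinearMap_span_singleton hWJ S hli, ?_⟩, fun v =>
      DiffOp.nonempty_span_singleton_equiv hWJ (v : DiffOp.invariants k R M).2 fun h =>
        hli.ne_zero v (Subtype.ext h)⟩,
    DiffOp.isSimpleModule_quotient_leftIdeal hWJ, DiffOp.finrank_invariants_quotient_leftIdeal hWJ⟩
  exact LinearMap.range_eq_top.1 (DirectSum.range_coeLinearMap.trans
    (DiffOp.iSup_span_singleton_eq_top hM S hspan))
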